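/- Conventions. For a semi-Riemannian metric $g$ with Christoffel symbols $\Gamma^a_{bc}$ in a coordinate domain of dimension $n$, put $$R_{abcd}=g_{a\alpha}\left(\partial_d\Gamma^\alpha_{bc}-\partial_c\Gamma^\alpha_{bd}+\Gamma^\beta_{bc}\Gamma^\alpha_{\beta d}-\Gamma^\beta_{bd}\Gamma^\alpha_{\beta c}\right),\quad S_{ab}=g^{\alpha\beta}R_{\alpha ab\beta},\quad \kappa=g^{ab}S_{ab},$$ $$(g\wedge g)_{abcd}=2(g_{ad}g_{bc}-g_{ac}g_{bd}).$$ For a covariant $k$-tensor $U$ put $$(R\cdot U)_{i_1\cdots i_kab}=-g^{\alpha\beta}\left[R_{abi_1\alpha}U_{\beta i_2\cdots i_k}+\cdots+R_{abi_k\alpha}U_{i_1\cdots i_{k-1}\beta}\right],$$ $$Q(g,U)_{i_1\cdots i_kab}=g_{bi_1}U_{ai_2\cdots i_k}+\cdots+g_{bi_k}U_{i_1\cdots i_{k-1}a}-g_{ai_1}U_{bi_2\cdots i_k}-\cdots-g_{ai_k}U_{i_1\cdots i_{k-1}b}.$$ $(M,g)$ is pseudosymmetric if $R\cdot R=f\,Q(g,R)$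 for some scalar function $f$ on the set of points where $R-\frac{\kappa}{2n(n-1)}\,g\wedge g\neq 0$, and Ricci pseudosymmetric if $R\cdot S=f\,Q(g,S)$ for some scalar function $f$ on the set of points where $S-\frac{\kappa}{n}g\ne0$. Theorem. Let $m\in\mathbb R$ and let $M$ be any non-empty open subset of the region $\eta\neq0$, $r\ne0$, $\sin\theta\neq0$ of $\mathbb R^5$ with coordinates $(\eta,u,r,\theta,\phi)$ (numbered $1,\dots,5$). Then $$g=\eta^2\left[d\eta^2-\left(1-\frac{2m}{r}\right)du^2-2\,du\,dr+r^2\left(d\theta^2+\sin^2\theta\,d\phi^2\right)\right]$$ is a smooth semi-Riemannian metric on $M$, and $(M,g)$ is Ricci pseudosymmetric; in fact $$R\cdot S=-\frac1{\eta^4}\,Q(g,S)$$ everywhere on $M$. With $T=R\cdot S$, $c=6/\eta^4$, and also with $T=Q(g,S)$, $c=-6$, the tensor $T$ is symmetric in its first two and antisymmetric in its last two indices, and, up to these symmetries, all its components are zero except for $$T_{1212}=\frac{c(r-2m)}{r},\quad T_{1312}=T_{1213}=c,\quad T_{1414}=-c\,r^2,\quad T_{1515}=-c\,r^2\sin^2\theta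 .$$ If $m\neq0$, then $(M,g)$ is not pseudosymmetric. -/

import Mathlib

open scoped ContDiff

namespace SemiRiem

/-- Components, at one point of an `n`-dimensional coordinate domain, of a covariant tensor of
type `(0,k)`. -/
abbrev CTensor (n k : ℕ) : Type := (Fin k → Fin n) → ℝ

/-- Components at one point of a tensor of type `(0,k+2)`, written `T i a b` with the last two
indices `a b` separated from the first `k` indices `i`. -/
abbrev CTensorTwo (n k : ℕ) : Type := (Fin k → Fin n) → Fin n → Fin n → ℝ

/-- A field of `n × n` matrices on `ℝⁿ` : the components `g_{ab}` of a metric in the standard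
coordinates. -/
abbrev MetricField (n : ℕ) : Type := (Fin n → ℝ) → Matrix (Fin n) (Fin n) ℝ

variable {n k : ℕ}

/-- The partial derivative `∂f/∂xⁱ` at `x`. -/
noncomputable def pderiv (i : Fin n) (f : (Fin n → ℝ) → ℝ) (x : Fin n → ℝ) : ℝ :=
  deriv (fun t : ℝ => f (Function.update x i t)) (x i)

/-- `g` is a (smooth, symmetric, non-degenerate) semi-Riemannian metric on `M ⊆ ℝⁿ`. -/
structure IsMetricOn (g : MetricField n) (M : Set (Fin n → ℝ)) : Prop where
  smooth : ∀ a b, ContDiffOn ℝ ∞ (fun x => g x a b) M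
  symm : ∀ x ∈ M, (g x).IsSymm
  nondegenerate : ∀ x ∈ M, (g x).det ≠ 0

/-- The metric at `x` as a tensor of type `(0,2)`. -/
def metricTensor (g : MetricField n) (x : Fin n → ℝ) : CTensor n 2 :=
  fun i => g x (i 0) (i 1)

/-- The Christoffel symbols of the second kind `Γ^a_{bc}` of the Levi-Civita connection. -/
noncomputable def christoffel (g : MetricField n) (a b c : Fin n) (x : Fin n → ℝ) : ℝ :=
  (1 / 2) * ∑ d, (g x)⁻¹ a d *
    (pderiv b (fun y => g y d c) x + pderiv c (fun y => g y d b) x - pderiv d (fun y => g y b c) x)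

/-- The Riemann curvature tensor
`R_{abcd} = g_{aα} (∂_d Γ^α_{bc} - ∂_c Γ^α_{bd} + Γ^β_{bc} Γ^α_{βd} - Γ^β_{bd} Γ^α_{βc})`. -/
noncomputable def riemann (g : MetricField n) (x : Fin n → ℝ) : CTensor n 4 :=
  fun i => ∑ α, g x (i 0) α *
    (pderiv (i 3) (christoffel g α (i 1) (i 2)) x - pderiv (i 2) (christoffel g α (i 1) (i 3)) x
      + ∑ β, (christoffel g β (i 1) (i 2) x * christoffel g α β (i 3) x
        - christoffel g β (i 1) (i 3) x * christoffel g α β (i 2) x))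

/-- The Ricci tensor `S_{ab} = g^{αβ} R_{αabβ}`. -/
noncomputable def ricci (g : MetricField n) (x : Fin n → ℝ) : CTensor n 2 :=
  fun i => ∑ α, ∑ β, (g x)⁻¹ α β * riemann g x ![α, i 0, i 1, β]

/-- The scalar curvature `κ = g^{ab} S_{ab}`. -/
noncomputable def scalarCurv (g : MetricField n) (x : Fin n → ℝ) : ℝ :=
  ∑ a, ∑ b, (g x)⁻¹ a b * ricci g x ![a, b]

/-- The Kulkarni-Nomizu product
`(E ∧ D)_{abcd} = E_{ad} D_{bc} + E_{bc} D_{ad} - E_{ac} D_{bd} - E_{bd} D_{ac}`. -/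
def kulkarniNomizu (E D : CTensor n 2) : CTensor n 4 :=
  fun i => E ![i 0, i 3] * D ![i 1, i 2] + E ![i 1, i 2] * D ![i 0, i 3]
    - E ![i 0, i 2] * D ![i 1, i 3] - E ![i 1, i 3] * D ![i 0, i 2]

/-- The tensor `(L · U)_{i₁…i_k a b} = - g^{αβ} ∑_s L_{a b i_s α} U_{i₁ … β … i_k}`, with `β` in
the `s`-th slot; `G` is the matrix of the metric at the point under consideration. -/
noncomputable def dotAction (G : Matrix (Fin n) (Fin n) ℝ) (L : CTensor n 4) (U : CTensor n k) :
    CTensorTwo n k :=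
  fun i a b => -∑ s, ∑ α, ∑ β, G⁻¹ α β * (L ![a, b, i s, α] * U (Function.update i s β))

/-- The Tachibana tensor
`Q(N,U)_{i₁…i_k a b} = ∑_s (N_{b i_s} U_{i₁ … a … i_k} - N_{a i_s} U_{i₁ … b … i_k})`, with `a`,
respectively `b`, in the `s`-th slot of `U`. -/
def tachibana (N : CTensor n 2) (U : CTensor n k) : CTensorTwo n k :=
  fun i a b => ∑ s, (N ![b, i s] * U (Function.update i s a)
    - N ![a, i s] * U (Function.update i s b))

/-- `R · R` at `x`. -/
noncomputable def RdotR (g : MetricField n) (x : Fin n → ℝ) : CTensorTwo n 4 :=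
  dotAction (g x) (riemann g x) (riemann g x)

/-- `R · S` at `x`. -/
noncomputable def RdotS (g : MetricField n) (x : Fin n → ℝ) : CTensorTwo n 2 :=
  dotAction (g x) (riemann g x) (ricci g x)

/-- `Q(g,R)` at `x`. -/
noncomputable def QgR (g : MetricField n) (x : Fin n → ℝ) : CTensorTwo n 4 :=
  tachibana (metricTensor g x) (riemann g x)

/-- `Q(g,S)` at `x`. -/
noncomputable def QgS (g : MetricField n) (x : Fin n → ℝ) : CTensorTwo n 2 :=
  tachibana (metricTensor g x) (ricci g x)

/-- The set `𝒰_R` of the points of `M` at which `R - κ / (2n(n-1)) (g ∧ g) ≠ 0`. -/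
def setUR (g : MetricField n) (M : Set (Fin n → ℝ)) : Set (Fin n → ℝ) :=
  {x | x ∈ M ∧ riemann g x - (scalarCurv g x / (2 * (n : ℝ) * ((n : ℝ) - 1))) •
    kulkarniNomizu (metricTensor g x) (metricTensor g x) ≠ 0}

/-- The set `𝒰_S` of the points of `M` at which `S - (κ / n) g ≠ 0`. -/
def setUS (g : MetricField n) (M : Set (Fin n → ℝ)) : Set (Fin n → ℝ) :=
  {x | x ∈ M ∧ ricci g x - (scalarCurv g x / (n : ℝ)) • metricTensor g x ≠ 0}

/-- `(M, g)` is pseudosymmetric: `R · R = f Q(g,R)` on `𝒰_R` for some scalar function `f`. -/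
def IsPseudosymmetric (g : MetricField n) (M : Set (Fin n → ℝ)) : Prop :=
  ∃ f : setUR g M → ℝ, ∀ x : setUR g M, RdotR g x = f x • QgR g x

/-- `(M, g)` is Ricci pseudosymmetric: `R · S = f Q(g,S)` on `𝒰_S` for some scalar function
`f`. -/
def IsRicciPseudosymmetric (g : MetricField n) (M : Set (Fin n → ℝ)) : Prop :=
  ∃ f : setUS g M → ℝ, ∀ x : setUS g M, RdotS g x = f x • QgS g x

/-- The metric `η² [dη² - (1 - 2m/r) du² - 2 du dr + r² (dθ² + sin² θ dφ²)]` in the coordinates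
`(x 0, x 1, x 2, x 3, x 4) = (η, u, r, θ, φ)` of `ℝ⁵`. -/
noncomputable def schwarzschildFive (m : ℝ) : MetricField 5 := fun x =>
  (x 0) ^ 2 •
    !![1, 0, 0, 0, 0;
       0, -(1 - 2 * m / x 2), -1, 0, 0;
       0, -1, 0, 0, 0;
       0, 0, 0, (x 2) ^ 2, 0;
       0, 0, 0, 0, (x 2) ^ 2 * Real.sin (x 3) ^ 2]

/-- The part `η ≠ 0`, `r ≠ 0`, `sin θ ≠ 0` of `ℝ⁵` where the metric above is defined and
non-degenerate. -/
def regularDomain : Set (Fin 5 → ℝ) := {x | x 0 ≠ 0 ∧ x 2 ≠ 0 ∧ Real.sin (x 3) ≠ 0}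

/-- With indices numbered from `1` as usual (so `T ![0, 1] 0 1` is `T_{1212}`): `T` is symmetric
in its first and antisymmetric in its last two indices, up to these symmetries its components
that need not vanish are
`T_{1212} = c (r - 2m) / r`, `T_{1312} = T_{1213} = c`, `T_{1414} = -c r²`,
`T_{1515} = -c r² sin² θ`, and all others are zero. -/
structure HasListedComponents (T : CTensorTwo 5 2) (c m r θ : ℝ) : Prop where
  symm : ∀ i j a b, T ![j, i] a b = T ![i, j] a b
  antisymm : ∀ i j a b, T ![i, j] b a = -T ![i, j] a b
  c1212 : T ![0, 1] 0 1 = c * (r - 2 * m) / r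
  c1312 : T ![0, 2] 0 1 = c
  c1213 : T ![0, 1] 0 2 = c
  c1414 : T ![0, 3] 0 3 = -c * r ^ 2
  c1515 : T ![0, 4] 0 4 = -c * r ^ 2 * Real.sin θ ^ 2
  /-- The other components with exactly one index `1` in each pair. -/
  rest : ∀ j b : Fin 5, j ≠ 0 → b ≠ 0 →
    (j, b) ∉ ({(1, 1), (2, 1), (1, 2), (3, 3), (4, 4)} : Set (Fin 5 × Fin 5)) → T ![0, j] 0 b = 0
  /-- The components whose first pair does not contain the index `1`. -/
  first : ∀ i j a b : Fin 5, i ≠ 0 → j ≠ 0 → T ![i, j] a b = 0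
  /-- The components whose first pair is `11`. -/
  firstDiag : ∀ a b : Fin 5, T ![0, 0] a b = 0
  /-- The components whose last pair does not contain the index `1`. -/
  last : ∀ i j a b : Fin 5, a ≠ 0 → b ≠ 0 → T ![i, j] a b = 0

end SemiRiem

namespace SemiRiem

variable {k : ℕ}

/-! Substituting s = η²/2 gives g = ds² + 2s h, a warped product whose fibre h is the Ricci-flat
Schwarzschild metric. The curvature is therefore block-diagonal: R_{abcd} = κ_{ab}(g_{ad} g_{bc} -
g_{ac} g_{bd}), with κ equal to K = 1/η⁴ on planes containing ∂_η, to A inside the blocks {u,r} and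
{θ,φ}, and to B across them, where A - B = 3m/(r³η²) (`riemann_schwarzschildFive'`).

Raising an index then gives (R·U)_{…ab} = -κ_{ab} Q(g,U)_{…ab} for every U
(`dotAction_schwarzschildFive`), so pseudosymmetry-type conditions only compare the κ_{ab} at those
pairs where Q(g,U) is nonzero. For U = S, the Ricci tensor is a multiple of g on ∂_η and another on
the fibre, so Q(g,S) lives only on pairs containing η, where κ = K. For U = R and m ≠ 0, Q(g,R) is
nonzero both at a pair with κ = K and at one with κ = B, wherever K ≠ B; no single f serves both. -/

/-! ### The metric, its inverse and its first derivatives. -/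

/-- The components `g^{ab}` of the inverse of the metric `schwarzschildFive m`. -/
noncomputable def inverseMetric (m : ℝ) : MetricField 5 := fun x =>
  ((x 0) ^ 2)⁻¹ •
    !![1, 0, 0, 0, 0;
       0, 0, -1, 0, 0;
       0, -1, 1 - 2 * m / x 2, 0, 0;
       0, 0, 0, ((x 2) ^ 2)⁻¹, 0;
       0, 0, 0, 0, ((x 2) ^ 2)⁻¹ * (Real.sin (x 3) ^ 2)⁻¹]

lemma schwarzschildFive_mul_inverseMetric {m : ℝ} {x : Fin 5 → ℝ} (hx : x ∈ regularDomain) :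
    schwarzschildFive m x * inverseMetric m x = 1 := by
  obtain ⟨h0, h2, h3⟩ := hx
  unfold schwarzschildFive inverseMetric
  rw [Matrix.smul_mul, Matrix.mul_smul, smul_smul, mul_inv_cancel₀ (pow_ne_zero 2 h0), one_smul]
  ext i j
  fin_cases i <;> fin_cases j <;> simp [Matrix.mul_apply, Fin.sum_univ_five, h2]
  field_simp

lemma schwarzschildFive_inv {m : ℝ} {x : Fin 5 → ℝ} (hx : x ∈ regularDomain) :
    (schwarzschildFive m x)⁻¹ = inverseMetric m x :=
  Matrix.inv_eq_right_inv (schwarzschildFive_mul_inverseMetric hx)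

lemma schwarzschildFive_det_ne_zero {m : ℝ} {x : Fin 5 → ℝ} (hx : x ∈ regularDomain) :
    (schwarzschildFive m x).det ≠ 0 :=
  Matrix.det_ne_zero_of_right_inverse (schwarzschildFive_mul_inverseMetric hx)

/-- The partial derivatives `∂ᵢ g_{ab}` of the metric `schwarzschildFive m`. -/
noncomputable def metricDeriv (m : ℝ) (x : Fin 5 → ℝ) : Fin 5 → Matrix (Fin 5) (Fin 5) ℝ
  | 0 => (2 * (x 0)) •
      !![1, 0, 0, 0, 0;
         0, -(1 - 2 * m / x 2), -1, 0, 0;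
         0, -1, 0, 0, 0;
         0, 0, 0, (x 2) ^ 2, 0;
         0, 0, 0, 0, (x 2) ^ 2 * Real.sin (x 3) ^ 2]
  | 1 => 0
  | 2 => (x 0) ^ 2 •
      !![0, 0, 0, 0, 0;
         0, -(2 * m / (x 2) ^ 2), 0, 0, 0;
         0, 0, 0, 0, 0;
         0, 0, 0, 2 * x 2, 0;
         0, 0, 0, 0, 2 * x 2 * Real.sin (x 3) ^ 2]
  | 3 => (x 0) ^ 2 •
      !![0, 0, 0, 0, 0;
         0, 0, 0, 0, 0;
         0, 0, 0, 0, 0;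
         0, 0, 0, 0, 0;
         0, 0, 0, 0, (x 2) ^ 2 * (2 * Real.sin (x 3) * Real.cos (x 3))]
  | 4 => 0

lemma pderiv_schwarzschildFive {m : ℝ} {x : Fin 5 → ℝ} (hx : x ∈ regularDomain)
    (i a b : Fin 5) :
    pderiv i (fun y => schwarzschildFive m y a b) x = metricDeriv m x i a b := by
  obtain ⟨h0, h2, h3⟩ := hx
  have hinv : HasDerivAt (fun t : ℝ => 2 * m / t) (-(2 * m / (x 2) ^ 2)) (x 2) := by
    have := (hasDerivAt_inv h2).const_mul (2 * m)
    simpa [div_eq_mul_inv] using this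
  have hsin : HasDerivAt (fun t : ℝ => Real.sin t ^ 2)
      (2 * Real.sin (x 3) * Real.cos (x 3)) (x 3) := by
    simpa using (Real.hasDerivAt_sin (x 3)).fun_pow 2
  unfold pderiv
  fin_cases i <;> fin_cases a <;> fin_cases b <;>
    simp [schwarzschildFive, metricDeriv, hinv.deriv, hsin.deriv]

/-! ### The Levi-Civita connection and its derivatives. -/

/-- The connection matrices: `connectionMatrix m x c a b` is the Christoffel symbol `Γ^a_{bc}` of
`schwarzschildFive m` at `x`. -/
noncomputable def connectionMatrix (m : ℝ) (x : Fin 5 → ℝ) : Fin 5 → Matrix (Fin 5) (Fin 5) ℝ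
  | 0 =>
      !![(x 0)⁻¹, 0, 0, 0, 0;
         0, (x 0)⁻¹, 0, 0, 0;
         0, 0, (x 0)⁻¹, 0, 0;
         0, 0, 0, (x 0)⁻¹, 0;
         0, 0, 0, 0, (x 0)⁻¹]
  | 1 =>
      !![0, (1 - 2 * m * (x 2)⁻¹) * (x 0)⁻¹, (x 0)⁻¹, 0, 0;
         (x 0)⁻¹, -m * (x 2 ^ 2)⁻¹, 0, 0, 0;
         0, (1 - 2 * m * (x 2)⁻¹) * (m * (x 2 ^ 2)⁻¹), m * (x 2 ^ 2)⁻¹, 0, 0;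
         0, 0, 0, 0, 0;
         0, 0, 0, 0, 0]
  | 2 =>
      !![0, (x 0)⁻¹, 0, 0, 0;
         0, 0, 0, 0, 0;
         (x 0)⁻¹, m * (x 2 ^ 2)⁻¹, 0, 0, 0;
         0, 0, 0, (x 2)⁻¹, 0;
         0, 0, 0, 0, (x 2)⁻¹]
  | 3 =>
      !![0, 0, 0, -(x 2) ^ 2 * (x 0)⁻¹, 0;
         0, 0, 0, x 2, 0;
         0, 0, 0, 2 * m - x 2, 0;
         (x 0)⁻¹, 0, (x 2)⁻¹, 0, 0;
         0, 0, 0, 0, Real.cos (x 3) * (Real.sin (x 3))⁻¹]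
  | 4 =>
      !![0, 0, 0, 0, -(x 2) ^ 2 * Real.sin (x 3) ^ 2 * (x 0)⁻¹;
         0, 0, 0, 0, x 2 * Real.sin (x 3) ^ 2;
         0, 0, 0, 0, (2 * m - x 2) * Real.sin (x 3) ^ 2;
         0, 0, 0, 0, -(Real.sin (x 3) * Real.cos (x 3));
         (x 0)⁻¹, 0, (x 2)⁻¹, Real.cos (x 3) * (Real.sin (x 3))⁻¹, 0]

set_option maxHeartbeats 2000000 in
lemma christoffel_schwarzschildFive {m : ℝ} {x : Fin 5 → ℝ} (hx : x ∈ regularDomain)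
    (a b c : Fin 5) :
    christoffel (schwarzschildFive m) a b c x = connectionMatrix m x c a b := by
  unfold christoffel
  simp only [pderiv_schwarzschildFive hx, schwarzschildFive_inv hx]
  obtain ⟨h0, h2, h3⟩ := hx
  fin_cases c <;> fin_cases a <;> fin_cases b <;>
    simp [metricDeriv, inverseMetric, connectionMatrix, Fin.sum_univ_five] <;> field_simp <;> ring

/-- The partial derivatives `∂ᵢ Γ^a_{bc}`, as `connectionDeriv m x i c a b`. -/
noncomputable def connectionDeriv (m : ℝ) (x : Fin 5 → ℝ) :
    Fin 5 → Fin 5 → Matrix (Fin 5) (Fin 5) ℝ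
  | 0, 0 => -(x 0 ^ 2)⁻¹ •
      !![1, 0, 0, 0, 0;
         0, 1, 0, 0, 0;
         0, 0, 1, 0, 0;
         0, 0, 0, 1, 0;
         0, 0, 0, 0, 1]
  | 0, 1 => -(x 0 ^ 2)⁻¹ •
      !![0, 1 - 2 * m * (x 2)⁻¹, 1, 0, 0;
         1, 0, 0, 0, 0;
         0, 0, 0, 0, 0;
         0, 0, 0, 0, 0;
         0, 0, 0, 0, 0]
  | 0, 2 => -(x 0 ^ 2)⁻¹ •
      !![0, 1, 0, 0, 0;
         0, 0, 0, 0, 0;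
         1, 0, 0, 0, 0;
         0, 0, 0, 0, 0;
         0, 0, 0, 0, 0]
  | 0, 3 => -(x 0 ^ 2)⁻¹ •
      !![0, 0, 0, -(x 2) ^ 2, 0;
         0, 0, 0, 0, 0;
         0, 0, 0, 0, 0;
         1, 0, 0, 0, 0;
         0, 0, 0, 0, 0]
  | 0, 4 => -(x 0 ^ 2)⁻¹ •
      !![0, 0, 0, 0, -(x 2) ^ 2 * Real.sin (x 3) ^ 2;
         0, 0, 0, 0, 0;
         0, 0, 0, 0, 0;
         0, 0, 0, 0, 0;
         1, 0, 0, 0, 0]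
  | 2, 1 =>
      !![0, 2 * m * (x 2 ^ 2)⁻¹ * (x 0)⁻¹, 0, 0, 0;
         0, 2 * m * (x 2 ^ 3)⁻¹, 0, 0, 0;
         0, 6 * m ^ 2 * (x 2 ^ 4)⁻¹ - 2 * m * (x 2 ^ 3)⁻¹, -2 * m * (x 2 ^ 3)⁻¹, 0, 0;
         0, 0, 0, 0, 0;
         0, 0, 0, 0, 0]
  | 2, 2 =>
      !![0, 0, 0, 0, 0;
         0, 0, 0, 0, 0;
         0, -2 * m * (x 2 ^ 3)⁻¹, 0, 0, 0;
         0, 0, 0, -(x 2 ^ 2)⁻¹, 0;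
         0, 0, 0, 0, -(x 2 ^ 2)⁻¹]
  | 2, 3 =>
      !![0, 0, 0, -(2 * x 2) * (x 0)⁻¹, 0;
         0, 0, 0, 1, 0;
         0, 0, 0, -1, 0;
         0, 0, -(x 2 ^ 2)⁻¹, 0, 0;
         0, 0, 0, 0, 0]
  | 2, 4 =>
      !![0, 0, 0, 0, -(2 * x 2) * Real.sin (x 3) ^ 2 * (x 0)⁻¹;
         0, 0, 0, 0, Real.sin (x 3) ^ 2;
         0, 0, 0, 0, -Real.sin (x 3) ^ 2;
         0, 0, 0, 0, 0;
         0, 0, -(x 2 ^ 2)⁻¹, 0, 0]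
  | 3, 3 =>
      !![0, 0, 0, 0, 0;
         0, 0, 0, 0, 0;
         0, 0, 0, 0, 0;
         0, 0, 0, 0, 0;
         0, 0, 0, 0, -(1 + (Real.cos (x 3) * (Real.sin (x 3))⁻¹) ^ 2)]
  | 3, 4 =>
      !![0, 0, 0, 0, -(x 2) ^ 2 * (2 * Real.sin (x 3) * Real.cos (x 3)) * (x 0)⁻¹;
         0, 0, 0, 0, x 2 * (2 * Real.sin (x 3) * Real.cos (x 3));
         0, 0, 0, 0, (2 * m - x 2) * (2 * Real.sin (x 3) * Real.cos (x 3));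
         0, 0, 0, 0, Real.sin (x 3) ^ 2 - Real.cos (x 3) ^ 2;
         0, 0, 0, -(1 + (Real.cos (x 3) * (Real.sin (x 3))⁻¹) ^ 2), 0]
  | _, _ => 0

lemma isOpen_regularDomain : IsOpen regularDomain := by
  refine IsOpen.inter ?_ (IsOpen.inter ?_ ?_) <;>
    exact isOpen_ne_fun (by fun_prop) continuous_const

lemma eventually_update_mem_regularDomain {x : Fin 5 → ℝ} (hx : x ∈ regularDomain) (i : Fin 5) :
    ∀ᶠ t in nhds (x i), Function.update x i t ∈ regularDomain := by
  have hc : Continuous fun t : ℝ => Function.update x i t :=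
    continuous_const.update i continuous_id
  refine hc.continuousAt.eventually ?_
  simp only [Function.update_eq_self]
  exact isOpen_regularDomain.mem_nhds hx

set_option maxHeartbeats 4000000 in
lemma pderiv_connectionMatrix {m : ℝ} {x : Fin 5 → ℝ} (hx : x ∈ regularDomain)
    (i c a b : Fin 5) :
    pderiv i (fun y => connectionMatrix m y c a b) x = connectionDeriv m x i c a b := by
  obtain ⟨h0, h2, h3⟩ := hx
  have hinv2 : HasDerivAt (fun t : ℝ => (t ^ 2)⁻¹) (-2 * (x 2 ^ 3)⁻¹) (x 2) := by
    refine ((hasDerivAt_id' (x 2)).fun_pow 2).fun_inv (pow_ne_zero 2 h2) |>.congr_deriv ?_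
    field_simp
    norm_num
    ring
  have hprod : HasDerivAt (fun t : ℝ => (1 - 2 * m * t⁻¹) * (m * (t ^ 2)⁻¹))
      (6 * m ^ 2 * (x 2 ^ 4)⁻¹ - 2 * m * (x 2 ^ 3)⁻¹) (x 2) := by
    refine (((hasDerivAt_inv h2).const_mul (2 * m)).const_sub 1).fun_mul (hinv2.const_mul m)
      |>.congr_deriv ?_
    field_simp
    ring
  have hsin : HasDerivAt (fun t : ℝ => Real.sin t ^ 2)
      (2 * Real.sin (x 3) * Real.cos (x 3)) (x 3) := by
    simpa using (Real.hasDerivAt_sin (x 3)).fun_pow 2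
  have hsc : HasDerivAt (fun t : ℝ => Real.sin t * Real.cos t)
      (Real.cos (x 3) ^ 2 - Real.sin (x 3) ^ 2) (x 3) := by
    refine (Real.hasDerivAt_sin (x 3)).fun_mul (Real.hasDerivAt_cos (x 3)) |>.congr_deriv ?_
    ring
  have hcot : HasDerivAt (fun t : ℝ => Real.cos t * (Real.sin t)⁻¹)
      (-(1 + (Real.cos (x 3) * (Real.sin (x 3))⁻¹) ^ 2)) (x 3) := by
    refine (Real.hasDerivAt_cos (x 3)).fun_mul ((Real.hasDerivAt_sin (x 3)).fun_inv h3)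
      |>.congr_deriv ?_
    field_simp
    ring
  have hu : ∀ t, connectionMatrix m (Function.update x 1 t) c = connectionMatrix m x c := by
    intro t; fin_cases c <;> simp [connectionMatrix]
  have hφ : ∀ t, connectionMatrix m (Function.update x 4 t) c = connectionMatrix m x c := by
    intro t; fin_cases c <;> simp [connectionMatrix]
  have hu' : connectionDeriv m x 1 c = 0 := by fin_cases c <;> rfl
  have hφ' : connectionDeriv m x 4 c = 0 := by fin_cases c <;> rfl
  unfold pderiv
  fin_cases i
  on_goal 2 => simp [hu, hu']
  -- The goal for u is already closed, so the fourth remaining goal is the one for φ.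
  on_goal 4 => simp [hφ, hφ']
  all_goals
    fin_cases c <;> fin_cases a <;> fin_cases b <;>
      simp [connectionMatrix, connectionDeriv, hinv2.deriv, hprod.deriv, hsin.deriv, hsc.deriv,
        hcot.deriv] <;> ring

/-- The closed form of the symbols holds only on the open regular domain, hence near x on each
coordinate line, which suffices for the derivative. -/
lemma pderiv_christoffel {m : ℝ} {x : Fin 5 → ℝ} (hx : x ∈ regularDomain) (i a b c : Fin 5) :
    pderiv i (christoffel (schwarzschildFive m) a b c) x = connectionDeriv m x i c a b := by
  rw [← pderiv_connectionMatrix hx]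
  refine Filter.EventuallyEq.deriv_eq ?_
  filter_upwards [eventually_update_mem_regularDomain hx i] with t ht
  exact christoffel_schwarzschildFive ht a b c

/-! ### The curvature tensor and its action on tensors. -/

/-- The numbers `κ_{ab}` for which the curvature tensor of `schwarzschildFive m` at `x` is
`R_{abcd} = κ_{cd} (g_{ad} g_{bc} - g_{ac} g_{bd})`. -/
noncomputable def curvatureFactor (m : ℝ) (x : Fin 5 → ℝ) : Matrix (Fin 5) (Fin 5) ℝ :=
  let K := (x 0 ^ 4)⁻¹
  let A := 2 * m * (x 2 ^ 3)⁻¹ * (x 0 ^ 2)⁻¹ - (x 0 ^ 4)⁻¹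
  let B := -m * (x 2 ^ 3)⁻¹ * (x 0 ^ 2)⁻¹ - (x 0 ^ 4)⁻¹
  -- The diagonal entries multiply zero in R; the value A makes the rows of u and r identical, as
  -- g_{ur} ≠ 0 will require.
  !![K, K, K, K, K;
     K, A, A, B, B;
     K, A, A, B, B;
     K, B, B, A, A;
     K, B, B, A, A]

lemma curvatureFactor_symm (m : ℝ) (x : Fin 5 → ℝ) (a b : Fin 5) :
    curvatureFactor m x a b = curvatureFactor m x b a := by
  fin_cases a <;> fin_cases b <;> rfl

set_option maxHeartbeats 4000000 in
-- The mixed tensor R^a_{bcd} is checked entry by entry; antisymmetry in c, d later supplies the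
-- remaining pairs.
lemma curvatureOperator_of_lt {m : ℝ} {x : Fin 5 → ℝ} (hx : x ∈ regularDomain)
    {c d : Fin 5} (hcd : c < d) (a b : Fin 5) :
    connectionDeriv m x d c a b - connectionDeriv m x c d a b
      + ∑ e, (connectionMatrix m x c e b * connectionMatrix m x d a e
        - connectionMatrix m x d e b * connectionMatrix m x c a e)
      = curvatureFactor m x c d * ((1 : Matrix (Fin 5) (Fin 5) ℝ) a d * schwarzschildFive m x b c
        - (1 : Matrix (Fin 5) (Fin 5) ℝ) a c * schwarzschildFive m x b d) := by
  obtain ⟨h0, h2, h3⟩ := hx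
  fin_cases c <;> fin_cases d <;> first | exact absurd hcd (by decide) | skip
  all_goals
    fin_cases a <;> fin_cases b <;>
      simp [connectionMatrix, connectionDeriv, curvatureFactor, schwarzschildFive,
        Fin.sum_univ_five] <;> field_simp <;> ring

lemma curvatureOperator_schwarzschildFive {m : ℝ} {x : Fin 5 → ℝ} (hx : x ∈ regularDomain)
    (a b c d : Fin 5) :
    connectionDeriv m x d c a b - connectionDeriv m x c d a b
      + ∑ e, (connectionMatrix m x c e b * connectionMatrix m x d a e
        - connectionMatrix m x d e b * connectionMatrix m x c a e)
      = curvatureFactor m x c d * ((1 : Matrix (Fin 5) (Fin 5) ℝ) a d * schwarzschildFive m x b c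
        - (1 : Matrix (Fin 5) (Fin 5) ℝ) a c * schwarzschildFive m x b d) := by
  rcases lt_trichotomy c d with h | rfl | h
  · exact curvatureOperator_of_lt hx h a b
  · simp
  · have := curvatureOperator_of_lt (m := m) hx h a b
    rw [curvatureFactor_symm, Finset.sum_sub_distrib] at this
    rw [Finset.sum_sub_distrib]
    linarith

lemma schwarzschildFive_mul_inv {m : ℝ} {x : Fin 5 → ℝ} (hx : x ∈ regularDomain) :
    schwarzschildFive m x * (schwarzschildFive m x)⁻¹ = 1 :=
  Matrix.mul_nonsing_inv _ (isUnit_iff_ne_zero.mpr (schwarzschildFive_det_ne_zero hx))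

lemma schwarzschildFive_isSymm (m : ℝ) (x : Fin 5 → ℝ) : (schwarzschildFive m x).IsSymm := by
  ext a b
  fin_cases a <;> fin_cases b <;> rfl

lemma schwarzschildFive_symm (m : ℝ) (x : Fin 5 → ℝ) (a b : Fin 5) :
    schwarzschildFive m x a b = schwarzschildFive m x b a :=
  (schwarzschildFive_isSymm m x).apply b a

lemma schwarzschildFive_sum_inv {m : ℝ} {x : Fin 5 → ℝ} (hx : x ∈ regularDomain) (a b : Fin 5) :
    ∑ e, schwarzschildFive m x a e * (schwarzschildFive m x)⁻¹ e b
      = (1 : Matrix (Fin 5) (Fin 5) ℝ) a b := by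
  rw [← schwarzschildFive_mul_inv hx, Matrix.mul_apply]

lemma schwarzschildFive_eq_zero_or (m : ℝ) (x : Fin 5 → ℝ) (a b : Fin 5) :
    schwarzschildFive m x a b = 0 ∨
      ∀ c, curvatureFactor m x c a = curvatureFactor m x c b := by
  fin_cases a <;> fin_cases b <;>
    first
    | (refine Or.inr fun c => ?_; fin_cases c <;> rfl)
    | (refine Or.inl ?_; simp [schwarzschildFive])

lemma riemann_schwarzschildFive {m : ℝ} {x : Fin 5 → ℝ} (hx : x ∈ regularDomain)
    (i : Fin 4 → Fin 5) :
    riemann (schwarzschildFive m) x i = curvatureFactor m x (i 2) (i 3) *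
      (schwarzschildFive m x (i 0) (i 3) * schwarzschildFive m x (i 1) (i 2)
        - schwarzschildFive m x (i 0) (i 2) * schwarzschildFive m x (i 1) (i 3)) := by
  unfold riemann
  simp only [pderiv_christoffel hx, christoffel_schwarzschildFive hx,
    curvatureOperator_schwarzschildFive hx]
  simp only [mul_sub, Finset.sum_sub_distrib, Matrix.one_apply, ite_mul, mul_ite, one_mul,
    zero_mul, mul_zero, Finset.sum_ite_eq', Finset.mem_univ, if_true]
  ring

/-- Pair symmetry of R: moving the factor to the first pair lets it leave the contraction in
`dotAction`, which runs over the last index. -/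
lemma riemann_schwarzschildFive' {m : ℝ} {x : Fin 5 → ℝ} (hx : x ∈ regularDomain)
    (a b c d : Fin 5) :
    riemann (schwarzschildFive m) x ![a, b, c, d] = curvatureFactor m x a b *
      (schwarzschildFive m x a d * schwarzschildFive m x b c
        - schwarzschildFive m x a c * schwarzschildFive m x b d) := by
  have key : ∀ c d, curvatureFactor m x c d *
      (schwarzschildFive m x a d * schwarzschildFive m x b c) = curvatureFactor m x a b *
      (schwarzschildFive m x a d * schwarzschildFive m x b c) := by
    intro c d
    rcases schwarzschildFive_eq_zero_or m x a d with h | h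
    · simp [h]
    rcases schwarzschildFive_eq_zero_or m x b c with h' | h'
    · simp [h']
    rw [← h, curvatureFactor_symm, ← h']
  rw [riemann_schwarzschildFive hx]
  have h1 := key c d
  have h2 := key d c
  rw [curvatureFactor_symm] at h2
  simp only [Matrix.cons_val]
  linear_combination h1 - h2

/-- `R · U` agrees with `- κ_{ab} Q(g, U)` in the last two indices `a b`. -/
lemma dotAction_schwarzschildFive {m : ℝ} {x : Fin 5 → ℝ} (hx : x ∈ regularDomain)
    (U : CTensor 5 k) (i : Fin k → Fin 5) (a b : Fin 5) :
    dotAction (schwarzschildFive m x) (riemann (schwarzschildFive m) x) U i a b =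
      -(curvatureFactor m x a b *
        tachibana (metricTensor (schwarzschildFive m) x) U i a b) := by
  -- Inserting g g⁻¹ = 1 turns the entries of Q(g,U) into the double sums of R·U.
  have contract : ∀ (c : Fin 5) (V : Fin 5 → ℝ),
      ∑ α, ∑ β, schwarzschildFive m x c α * (schwarzschildFive m x)⁻¹ α β * V β = V c := by
    intro c V
    rw [Finset.sum_comm]
    simp [← Finset.sum_mul, schwarzschildFive_sum_inv hx, Matrix.one_apply]
  unfold dotAction tachibana metricTensor
  rw [Finset.mul_sum]
  congr 1
  refine Finset.sum_congr rfl fun s _ => ?_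
  rw [← contract a fun β => U (Function.update i s β),
    ← contract b fun β => U (Function.update i s β)]
  simp only [riemann_schwarzschildFive' hx, Finset.mul_sum, ← Finset.sum_sub_distrib]
  refine Finset.sum_congr rfl fun α _ => Finset.sum_congr rfl fun β _ => ?_
  simp only [Matrix.cons_val]
  ring

/-! ### The Ricci tensor and Q(g,S). -/

/-- The factors `ρ_a` for which the Ricci tensor of `schwarzschildFive m` at `x` is
`S_{ab} = ρ_b g_{ab}`. -/
noncomputable def ricciFactor (x : Fin 5 → ℝ) (a : Fin 5) : ℝ :=
  if a = 0 then 4 * (x 0 ^ 4)⁻¹ else -2 * (x 0 ^ 4)⁻¹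

lemma sum_curvatureFactor (m : ℝ) (x : Fin 5 → ℝ) (a : Fin 5) :
    ∑ b, curvatureFactor m x a b - curvatureFactor m x a a = ricciFactor x a := by
  fin_cases a <;> simp [curvatureFactor, ricciFactor, Fin.sum_univ_five] <;> ring

lemma ricci_schwarzschildFive {m : ℝ} {x : Fin 5 → ℝ} (hx : x ∈ regularDomain)
    (i : Fin 2 → Fin 5) :
    ricci (schwarzschildFive m) x i = ricciFactor x (i 1) * schwarzschildFive m x (i 0) (i 1) := by
  have contract : ∀ b c, ∑ α, schwarzschildFive m x α c * (schwarzschildFive m x)⁻¹ α b =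
      (1 : Matrix (Fin 5) (Fin 5) ℝ) c b := by
    intro b c
    have hs : ((schwarzschildFive m x)⁻¹).IsSymm := by
      rw [Matrix.IsSymm, Matrix.transpose_nonsing_inv, schwarzschildFive_isSymm m x]
    rw [← schwarzschildFive_sum_inv hx c b]
    refine Finset.sum_congr rfl fun α _ => ?_
    rw [schwarzschildFive_symm]
  unfold ricci
  rw [Finset.sum_comm, ← sum_curvatureFactor m x]
  have : ∀ β, ∑ α, (schwarzschildFive m x)⁻¹ α β *
      riemann (schwarzschildFive m) x ![α, i 0, i 1, β] =
      curvatureFactor m x (i 1) β * schwarzschildFive m x (i 0) (i 1)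
        - curvatureFactor m x (i 1) β * schwarzschildFive m x (i 0) β *
          (1 : Matrix (Fin 5) (Fin 5) ℝ) (i 1) β := by
    intro β
    -- With β fixed, the sum of g^{αβ} g_{αβ} over α alone is already 1, so κ_{cβ} may depend on β.
    have h1 := contract β β
    rw [Matrix.one_apply_eq] at h1
    rw [← contract β (i 1), ← mul_one (curvatureFactor m x (i 1) β * _), ← h1,
      Finset.mul_sum, Finset.mul_sum, ← Finset.sum_sub_distrib]
    refine Finset.sum_congr rfl fun α _ => ?_
    rw [riemann_schwarzschildFive hx]
    simp only [Matrix.cons_val]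
    ring
  simp only [this, Finset.sum_sub_distrib, ← Finset.sum_mul, Matrix.one_apply, mul_ite, mul_one,
    mul_zero, Finset.sum_ite_eq, Finset.mem_univ, if_true]
  ring

lemma QgS_schwarzschildFive {m : ℝ} {x : Fin 5 → ℝ} (hx : x ∈ regularDomain)
    (i : Fin 2 → Fin 5) (a b : Fin 5) :
    QgS (schwarzschildFive m) x i a b = (ricciFactor x (i 1) - ricciFactor x (i 0)) *
      (schwarzschildFive m x b (i 0) * schwarzschildFive m x a (i 1)
        - schwarzschildFive m x a (i 0) * schwarzschildFive m x b (i 1)) := by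
  have hρ : ∀ p q, ricciFactor x q * schwarzschildFive m x p q =
      ricciFactor x p * schwarzschildFive m x q p := by
    intro p q
    rw [schwarzschildFive_symm m x q p]
    rcases schwarzschildFive_eq_zero_or m x p q with h | h
    · simp [h]
    · rw [← sum_curvatureFactor m, ← sum_curvatureFactor m, ← h q, curvatureFactor_symm m x q p,
        h p, Finset.sum_congr rfl fun c _ => curvatureFactor_symm m x p c,
        Finset.sum_congr rfl fun c _ => curvatureFactor_symm m x q c,
        Finset.sum_congr rfl fun c _ => h c]
  unfold QgS tachibana metricTensor
  simp only [Fin.sum_univ_two, ricci_schwarzschildFive hx, Matrix.cons_val,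
    Function.update_self, ne_eq, one_ne_zero, zero_ne_one, not_false_eq_true,
    Function.update_of_ne]
  -- Symmetry of S moves its factor from a or b to i 0, so that the terms combine into a difference
  -- of ρ's.
  rw [hρ (i 0) a, hρ (i 0) b]
  ring

lemma isMetricOn_schwarzschildFive (m : ℝ) {M : Set (Fin 5 → ℝ)} (hM : M ⊆ regularDomain) :
    IsMetricOn (schwarzschildFive m) M where
  smooth a b := by
    have h11 : ContDiffOn ℝ ∞ (fun x : Fin 5 → ℝ => 2 * m / x 2) M :=
      contDiffOn_const.div (by fun_prop) fun x hx => (hM hx).2.1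
    have h44 : ContDiff ℝ ∞ (fun x : Fin 5 → ℝ => x 2 ^ 2 * Real.sin (x 3) ^ 2) := by fun_prop
    fin_cases a <;> fin_cases b <;> simp [schwarzschildFive] <;> fun_prop
  symm x _ := schwarzschildFive_isSymm m x
  nondegenerate _ hx := schwarzschildFive_det_ne_zero (hM hx)

/-! ### The identity for R·S and the list of components. -/

lemma RdotS_schwarzschildFive {m : ℝ} {x : Fin 5 → ℝ} (hx : x ∈ regularDomain) :
    RdotS (schwarzschildFive m) x = (-(1 / (x 0) ^ 4)) • QgS (schwarzschildFive m) x := by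
  funext i a b
  -- If a or b is 0 then κ_{ab} = K; otherwise Q(g,S) vanishes, since nonzero values need exactly
  -- one of i 0, i 1 to be 0, and g has no entries mixing η with the rest.
  have hK : curvatureFactor m x a b * QgS (schwarzschildFive m) x i a b
      = (x 0 ^ 4)⁻¹ * QgS (schwarzschildFive m) x i a b := by
    by_cases ha : a = 0
    · subst ha
      congr 1
      fin_cases b <;> rfl
    by_cases hb : b = 0
    · subst hb
      congr 1
      fin_cases a <;> rfl
    have hg : ∀ c, c ≠ 0 → schwarzschildFive m x c 0 = 0 := by
      intro c hc
      fin_cases c <;> simp [schwarzschildFive] at hc ⊢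
    rw [QgS_schwarzschildFive hx]
    by_cases h0 : i 0 = 0
    · simp [h0, hg a ha, hg b hb]
    by_cases h1 : i 1 = 0
    · simp [h1, hg a ha, hg b hb]
    simp [ricciFactor, h0, h1]
  have := dotAction_schwarzschildFive (m := m) hx (ricci (schwarzschildFive m) x) i a b
  change RdotS (schwarzschildFive m) x i a b
    = -(curvatureFactor m x a b * QgS (schwarzschildFive m) x i a b) at this
  rw [this, hK]
  simp

lemma HasListedComponents.smul {T : CTensorTwo 5 2} {c m r θ : ℝ}
    (h : HasListedComponents T c m r θ) (s : ℝ) : HasListedComponents (s • T) (s * c) m r θ where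
  symm i j a b := by simp [h.symm i j]
  antisymm i j a b := by simp [h.antisymm i j a b]
  c1212 := by simp only [Pi.smul_apply, smul_eq_mul, h.c1212]; ring
  c1312 := by simp [h.c1312]
  c1213 := by simp [h.c1213]
  c1414 := by simp only [Pi.smul_apply, smul_eq_mul, h.c1414]; ring
  c1515 := by simp only [Pi.smul_apply, smul_eq_mul, h.c1515]; ring
  rest j b hj hb hjb := by simp [h.rest j b hj hb hjb]
  first i j a b hi hj := by simp [h.first i j a b hi hj]
  firstDiag a b := by simp [h.firstDiag]
  last i j a b ha hb := by simp [h.last i j a b ha hb]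

lemma QgS_hasListedComponents {m : ℝ} {x : Fin 5 → ℝ} (hx : x ∈ regularDomain) :
    HasListedComponents (QgS (schwarzschildFive m) x) (-6) m (x 2) (x 3) := by
  have hg : ∀ c, c ≠ 0 → schwarzschildFive m x c 0 = 0 := by
    intro c hc
    fin_cases c <;> simp [schwarzschildFive] at hc ⊢
  have hQ := fun p q => QgS_schwarzschildFive (m := m) hx ![p, q]
  simp only [Matrix.cons_val] at hQ
  obtain ⟨h0, h2, h3⟩ := hx
  constructor
  · intro i j a b
    rw [hQ, hQ]
    ring
  · intro i j a b
    rw [hQ, hQ]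
    ring
  · rw [hQ]
    simp [schwarzschildFive, ricciFactor]
    field_simp
    ring
  · rw [hQ]
    simp [schwarzschildFive, ricciFactor]
    field_simp
    ring
  · rw [hQ]
    simp [schwarzschildFive, ricciFactor]
    field_simp
    ring
  · rw [hQ]
    simp [schwarzschildFive, ricciFactor]
    field_simp
    ring
  · rw [hQ]
    simp [schwarzschildFive, ricciFactor]
    field_simp
    ring
  · intro j b hj hb hjb
    rw [hQ]
    fin_cases j <;> fin_cases b <;> simp [schwarzschildFive] at hj hb hjb ⊢
  · intro i j a b hi hj
    rw [hQ]
    simp [ricciFactor, hi, hj]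
  · intro a b
    rw [hQ]
    simp
  · intro i j a b ha hb
    rw [hQ]
    by_cases hi : i = 0
    · simp [hi, hg a ha, hg b hb]
    by_cases hj : j = 0
    · simp [hj, hg a ha, hg b hb]
    simp [ricciFactor, hi, hj]

/-! ### Failure of pseudosymmetry for m ≠ 0. -/

/-- The excluded equation is K = B. On an open set η can vary with r fixed, so mη² is not locally
constant. -/
lemma exists_mem_ne {m : ℝ} (hm : m ≠ 0) {M : Set (Fin 5 → ℝ)} (hM : IsOpen M)
    (hne : M.Nonempty) (hsub : M ⊆ regularDomain) :
    ∃ x ∈ M, m * x 0 ^ 2 ≠ -2 * x 2 ^ 3 := by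
  obtain ⟨x, hx⟩ := hne
  by_contra! h
  have hc : Continuous fun t : ℝ => Function.update x 0 t :=
    continuous_const.update 0 continuous_id
  have hev : ∀ᶠ t in nhds (x 0), Function.update x 0 t ∈ M := by
    refine hc.continuousAt.eventually ?_
    simp only [Function.update_eq_self]
    exact hM.mem_nhds hx
  have hconst : (fun t : ℝ => m * t ^ 2) =ᶠ[nhds (x 0)] fun _ => -2 * x 2 ^ 3 := by
    filter_upwards [hev] with t ht
    simpa using h _ ht
  have hd := hconst.deriv_eq
  have h0 := (hsub hx).1
  simp [hm, h0] at hd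

lemma mem_setUR_schwarzschildFive {m : ℝ} (hm : m ≠ 0) {M : Set (Fin 5 → ℝ)}
    (hsub : M ⊆ regularDomain) {x : Fin 5 → ℝ} (hxM : x ∈ M) :
    x ∈ setUR (schwarzschildFive m) M := by
  refine ⟨hxM, fun h => ?_⟩
  have hx := hsub hxM
  -- The value of the scalar curvature is irrelevant: the two components force A = 2c and B = 2c,
  -- against A ≠ B.
  set c := scalarCurv (schwarzschildFive m) x / (2 * ((5 : ℕ) : ℝ) * (((5 : ℕ) : ℝ) - 1))
  have h1 := congrFun h ![3, 4, 4, 3]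
  have h2 := congrFun h ![1, 3, 3, 2]
  obtain ⟨h0, h2', h3⟩ := id hx
  simp [riemann_schwarzschildFive', hx, kulkarniNomizu, metricTensor, schwarzschildFive,
    curvatureFactor] at h1 h2
  field_simp at h1 h2
  have h1' := (mul_eq_zero.mp h1).resolve_left (mul_ne_zero h2' (pow_ne_zero 2 h3))
  have : 3 * m * x 0 ^ 2 = 0 := by linear_combination h1' + h2
  simp [hm, h0] at this

lemma not_isPseudosymmetric_schwarzschildFive {m : ℝ} (hm : m ≠ 0) {M : Set (Fin 5 → ℝ)}
    (hM : IsOpen M) (hne : M.Nonempty) (hsub : M ⊆ regularDomain) :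
    ¬ IsPseudosymmetric (schwarzschildFive m) M := by
  rintro ⟨f, hf⟩
  obtain ⟨x, hxM, hxne⟩ := exists_mem_ne hm hM hne hsub
  have hx := hsub hxM
  have hfx := hf ⟨x, mem_setUR_schwarzschildFive hm hsub hxM⟩
  generalize f _ = l at hfx
  have key : ∀ i a b, QgR (schwarzschildFive m) x i a b ≠ 0 → l = -curvatureFactor m x a b := by
    intro i a b hQ
    have h := congrFun (congrFun (congrFun hfx i) a) b
    have h' := dotAction_schwarzschildFive (m := m) hx (riemann (schwarzschildFive m) x) i a b
    change RdotR (schwarzschildFive m) x i a b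
      = -(curvatureFactor m x a b * QgR (schwarzschildFive m) x i a b) at h'
    rw [h'] at h
    refine mul_right_cancel₀ hQ ?_
    simpa using h.symm
  obtain ⟨h0, h2, h3⟩ := id hx
  -- This component is g_{00} g_{12} g_{33} (K - B), so l = -K.
  have h1 := key ![0, 1, 2, 3] 0 3 (by
    simp [QgR, tachibana, metricTensor, Fin.sum_univ_four, riemann_schwarzschildFive, hx,
      schwarzschildFive, curvatureFactor, Function.update_apply]
    field_simp
    intro hz
    apply hxne
    have := (mul_eq_zero.mp (hz.trans (mul_zero _))).resolve_left (pow_ne_zero 2 h0)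
    linarith)
  -- This one is g_{12} g_{33} g_{44} (B - A), nonzero because m ≠ 0, so l = -B.
  have h4 := key ![2, 4, 4, 3] 1 3 (by
    simp [QgR, tachibana, metricTensor, Fin.sum_univ_four, riemann_schwarzschildFive, hx,
      schwarzschildFive, curvatureFactor, Function.update_apply]
    field_simp
    intro hz
    have := (mul_eq_zero.mp hz).resolve_left
      (mul_ne_zero (mul_ne_zero (pow_ne_zero 2 h0) h2) (pow_ne_zero 2 h3))
    have : 3 * m * x 0 ^ 2 = 0 := by linear_combination this
    simp [hm, h0] at this)
  rw [h1] at h4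
  simp [curvatureFactor] at h4
  field_simp at h4
  apply hxne
  linarith

end SemiRiem

theorem mainTheorem1 (m : ℝ) (M : Set (Fin 5 → ℝ)) (hM : IsOpen M) (hne : M.Nonempty)
    (hsub : M ⊆ SemiRiem.regularDomain) :
    SemiRiem.IsMetricOn (SemiRiem.schwarzschildFive m) M ∧
    SemiRiem.IsRicciPseudosymmetric (SemiRiem.schwarzschildFive m) M ∧
    (∀ x ∈ M, SemiRiem.RdotS (SemiRiem.schwarzschildFive m) x =
      (-(1 / (x 0) ^ 4)) • SemiRiem.QgS (SemiRiem.schwarzschildFive m) x) ∧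
    (∀ x ∈ M, SemiRiem.HasListedComponents
      (SemiRiem.RdotS (SemiRiem.schwarzschildFive m) x) (6 / (x 0) ^ 4) m (x 2) (x 3)) ∧
    (∀ x ∈ M, SemiRiem.HasListedComponents
      (SemiRiem.QgS (SemiRiem.schwarzschildFive m) x) (-6) m (x 2) (x 3)) ∧
    (m ≠ 0 → ¬ SemiRiem.IsPseudosymmetric (SemiRiem.schwarzschildFive m) M) := by
  refine ⟨SemiRiem.isMetricOn_schwarzschildFive m hsub,
    ⟨fun x => -(1 / (x.1 0) ^ 4), fun x => SemiRiem.RdotS_schwarzschildFive (hsub x.2.1)⟩,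
    fun x hx => SemiRiem.RdotS_schwarzschildFive (hsub hx), fun x hx => ?_,
    fun x hx => SemiRiem.QgS_hasListedComponents (hsub hx),
    fun hm => SemiRiem.not_isPseudosymmetric_schwarzschildFive hm hM hne hsub⟩
  have h := (SemiRiem.QgS_hasListedComponents (m := m) (hsub hx)).smul (-(1 / (x 0) ^ 4))
  rw [← SemiRiem.RdotS_schwarzschildFive (hsub hx)] at h
  convert h using 1
  ring
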